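/- Let $N\ge 1$ and let $\Sigma=(A,B,C)\in\mathbb R^{n\times n}\times\mathbb R^{n\times m}\times\mathbb R^{p\times n}$. Write $\mathrm{He}\{M\}=M^T+M$, and $M\succ0$ ($M\prec 0$) for "symmetric positive (negative) definite". Let $\mathbf e_{(N,i)}$ be the $i$-th unit vector of $\mathbb R^N$, $\mathcal L_k=[\,\mathbf I_k\ \mathbf 0\,]$, $\mathcal R_k=[\,\mathbf 0\ \mathbf I_k\,]\in\mathbb R^{k\times(k+1)}$, $\mathbf T_N$ the $N\times N$ matrix with ones on the anti-diagonal and zeros elsewhere, and $\lceil k\rceil_N$ the remainder of $k$ modulo $N$. For gains $F^{(a,i)}\in\mathbb R^{m\times p}$ ($0\le i\le a\le N-1$) let $\mathcal F$ be the block lower triangular matrix in $\mathbb R^{Nm\times Np}$ whose block in row $r$ and column $s$ ($0\le s\le r\le N-1$) is $F^{(r,r-s)}$. The associated $N$-periodic control system is $$x(k+1)=Ax(k)+B\sum_{i=0}^{\lceil k\rceil_N}F^{(\lceil k\rceil_N,i)}Cx(k-i),$$ and $\mathcal A_{\rm LTI}(\mathcal F,\Sigma)$ is the $n\times n$ matrix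 with $x(k+N)=\mathcal A_{\rm LTI}(\mathcal F,\Sigma)x(k)$ whenever $N\mid k$; the equivalent LTI system is $\phi(t+1)=\mathcal A_{\rm LTI}(\mathcal F,\Sigma)\phi(t)$. It is computed recursively: with $\mathcal F^{(\delta)}$ the leading $\delta\times\delta$ blocks of $\mathcal F$ and $\Phi_0=\mathbf I_n$, for $\delta=1,\dots,N$ put $\mathcal A_\delta=[\,\mathbf 0\ \mathbf I_n\,]\big(\mathbf I_\delta\otimes A+(\mathbf I_\delta\otimes B)\mathcal F^{(\delta)}(\mathbf I_\delta\otimes C)\big)\Phi_{\delta-1}$ and $\Phi_\delta=\begin{bmatrix}\Phi_{\delta-1}\\ \mathcal A_\delta\end{bmatrix}$; then $\mathcal A_{\rm LTI}(\mathcal F,\Sigma)=\mathcal A_N$. For state-feedback gain matrices $\mathcal F\in\mathbb R^{Nm\times Nn}$ the same is used with $C=\mathbf I_n$. Put $\mathcal P(\mathcal A)=\{P\succ0:\mathcal A^TP\mathcal A-P\prec0\}$, and let $\mathcal S_{\rm SOF}^{(N)}(\Sigma)$ be the union of $\mathcal P(\mathcal A_{\rm LTI}(\mathcal F,\Sigma))$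 over all block lower triangular $\mathcal F\in\mathbb R^{Nm\times Np}$ with $\rho(\mathcal A_{\rm LTI}(\mathcal F,\Sigma))<1$. Put further $$\mathcal X_N(P,1)=\big(-\mathbf e_{(N+1,1)}\mathbf e_{(N+1,1)}^T+\mathbf e_{(N+1,N+1)}\mathbf e_{(N+1,N+1)}^T\big)\otimes P,\qquad \Pi_N=\begin{bmatrix}\mathbf e_{(N,1)}^T\otimes\mathbf I_n&\mathbf 0\\ \mathbf I_N\otimes A&\mathbf I_N\otimes B\end{bmatrix},$$ $$\mathcal C(\mathcal F)=\begin{bmatrix}\mathcal F(\mathbf I_N\otimes C)&-\mathbf I_{Nm}\\ \mathcal L_{N-1}\otimes A-\mathcal R_{N-1}\otimes\mathbf I_n&\mathcal L_{N-1}\otimes B\end{bmatrix},\qquad \mathcal H(\mathcal F)=\begin{bmatrix}\mathcal F&-\mathbf I_{Nm}\\ \mathcal L_{N-1}\otimes A-\mathcal R_{N-1}\otimes\mathbf I_n&\mathcal L_{N-1}\otimes B\end{bmatrix}.$$ Assume: (a) $\hat P=\hat P^T\in\mathbb R^{n\times n}$ and the block upper triangular matrices $\hat{\mathcal G}\in\mathbb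 R^{Nn\times Nn}$ (blocks $n\times n$), $\hat{\mathcal J}\in\mathbb R^{Nm\times Nn}$ (blocks $m\times n$) satisfy Ebihara's LMI $$\mathcal X_N(\hat P,1)+\mathrm{He}\{(\mathcal L_N^T\otimes A)\hat{\mathcal G}(\mathcal R_N\otimes\mathbf I_n)+(\mathcal L_N^T\otimes B)\hat{\mathcal J}(\mathcal R_N\otimes\mathbf I_n)-(\mathcal R_N^T\otimes\mathbf I_n)\hat{\mathcal G}(\mathcal R_N\otimes\mathbf I_n)\}\prec0,$$ and $\hat{\mathcal F}_{\rm SF}=(\mathbf T_N\otimes\mathbf I_m)\hat{\mathcal J}\hat{\mathcal G}^{-1}(\mathbf T_N\otimes\mathbf I_n)$; (b) $\mathcal P(\mathcal A_{\rm LTI}(\hat{\mathcal F}_{\rm SF},(A,B,\mathbf I_n)))\cap\mathcal S_{\rm SOF}^{(N)}(\Sigma)\neq\emptyset$. Then there is a block lower triangular gain matrix $\mathcal F_{\rm SOF}\in\mathbb R^{Nm\times Np}$ for which the $N$-periodic control system is asymptotically stable if and only if there are a block lower triangular $\mathcal F_{\rm SOF}\in\mathbb R^{Nm\times Np}$, a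 symmetric $P\in\mathbb R^{n\times n}$ and a $\mathcal V\in\mathbb R^{((N-1)n+Nm)\times((N-1)n+Nm)}$ with $$P\succ0,\qquad \Pi_N^T\mathcal X_N(P,1)\Pi_N+\mathrm{He}\{\mathcal H(\hat{\mathcal F}_{\rm SF})^T\mathcal V\,\mathcal C(\mathcal F_{\rm SOF})\}\prec0;$$ the same equivalence holds with the equivalent LTI system in place of the $N$-periodic control system. Moreover, every $\mathcal F_{\rm SOF}$ for which these inequalities hold with some $P$ and $\mathcal V$ makes both the $N$-periodic control system and the equivalent LTI system asymptotically stable. -/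

import Mathlib

open scoped Kronecker Topology

namespace PeriodicSOF

/-- `He{M} = Mᵀ + M`. -/
def He {ι : Type*} (M : Matrix ι ι ℝ) : Matrix ι ι ℝ := M.transpose + M

/-- `M ≺ 0`: the real matrix `M` is symmetric negative definite. -/
def NegDef {ι : Type*} [Fintype ι] (M : Matrix ι ι ℝ) : Prop := (-M).PosDef

/-- The unit vector of dimension `N` with a `1` in the `i`-th component (components are counted
from `1`). -/
def unitVec (N i : ℕ) : Fin N → ℝ := fun j => if (j : ℕ) + 1 = i then 1 else 0

/-- The `k × l` matrix `[I 0]`; for `l = k + 1` this is the matrix `𝓛_k`. -/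
def matL (k l : ℕ) : Matrix (Fin k) (Fin l) ℝ :=
  Matrix.of fun i j => if (j : ℕ) = (i : ℕ) then 1 else 0

/-- For `l = k + 1` this is the `k × (k + 1)` matrix `𝓡_k = [0 I]`. -/
def matR (k l : ℕ) : Matrix (Fin k) (Fin l) ℝ :=
  Matrix.of fun i j => if (j : ℕ) = (i : ℕ) + 1 then 1 else 0

/-- The `N × N` matrix with ones on the anti-diagonal and zeros elsewhere. -/
def matT (N : ℕ) : Matrix (Fin N) (Fin N) ℝ :=
  Matrix.of fun i j => if (i : ℕ) + (j : ℕ) + 1 = N then 1 else 0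

variable {n m p N : ℕ}

/-! ### Closed-loop systems and asymptotic stability -/

/-- `x` is, from the initial time `k₀` on, a trajectory of the `N`-periodic control system
`x(k+1) = A x(k) + B ∑_{i=0}^{k mod N} F^{(k mod N, i)} C x(k-i)`.
(Only the gains `F a i` with `i ≤ a < N` occur.) -/
def IsTrajectory (N : ℕ) (A : Matrix (Fin n) (Fin n) ℝ) (B : Matrix (Fin n) (Fin m) ℝ)
    (C : Matrix (Fin p) (Fin n) ℝ) (F : ℕ → ℕ → Matrix (Fin m) (Fin p) ℝ)
    (k₀ : ℕ) (x : ℕ → Fin n → ℝ) : Prop :=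
  ∀ k, k₀ ≤ k → x (k + 1) = A.mulVec (x k) +
    B.mulVec (∑ i ∈ Finset.range (k % N + 1), (F (k % N) i).mulVec (C.mulVec (x (k - i))))

/-- Asymptotic stability of the origin of the `N`-periodic control system, for every initial time
`k₀`: Lyapunov stability and attractivity. The initial data at time `k₀` are the values
`x(k₀), …, x(k₀ - (k₀ mod N))` that the controller still remembers. -/
def PeriodicAsympStable (N : ℕ) (A : Matrix (Fin n) (Fin n) ℝ) (B : Matrix (Fin n) (Fin m) ℝ)
    (C : Matrix (Fin p) (Fin n) ℝ) (F : ℕ → ℕ → Matrix (Fin m) (Fin p) ℝ) : Prop :=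
  ∀ k₀ : ℕ,
    (∀ ε > 0, ∃ δ > 0, ∀ x : ℕ → Fin n → ℝ, IsTrajectory N A B C F k₀ x →
      (∀ i ≤ k₀ % N, ‖x (k₀ - i)‖ < δ) → ∀ k, k₀ ≤ k → ‖x k‖ < ε) ∧
    (∀ x : ℕ → Fin n → ℝ, IsTrajectory N A B C F k₀ x → Filter.Tendsto x Filter.atTop (𝓝 0))

/-- Asymptotic stability of the origin of the linear time-invariant system `φ(t+1) = 𝒜 φ(t)`. -/
def LTIAsympStable (𝒜 : Matrix (Fin n) (Fin n) ℝ) : Prop :=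
  (∀ ε > 0, ∃ δ > 0, ∀ φ : ℕ → Fin n → ℝ, (∀ t, φ (t + 1) = 𝒜.mulVec (φ t)) →
    ‖φ 0‖ < δ → ∀ t, ‖φ t‖ < ε) ∧
  (∀ φ : ℕ → Fin n → ℝ, (∀ t, φ (t + 1) = 𝒜.mulVec (φ t)) →
    Filter.Tendsto φ Filter.atTop (𝓝 0))

/-! ### The equivalent LTI system -/

/-- The block lower triangular gain matrix `𝓕^{(N,↓)}`: its block in row `r` and column `s`
(counted from `0`) is `F^{(r, r-s)}` if `s ≤ r`, and zero otherwise. -/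
def gainMatrix (N : ℕ) (F : ℕ → ℕ → Matrix (Fin m) (Fin p) ℝ) :
    Matrix (Fin N × Fin m) (Fin N × Fin p) ℝ :=
  Matrix.of fun r c =>
    if c.1 ≤ r.1 then F (r.1 : ℕ) ((r.1 : ℕ) - (c.1 : ℕ)) r.2 c.2 else 0

/-- `𝒜_AUG = I ⊗ A + (I ⊗ B) 𝓕 (I ⊗ C)`. -/
def augMatrix (A : Matrix (Fin n) (Fin n) ℝ) (B : Matrix (Fin n) (Fin m) ℝ)
    (C : Matrix (Fin p) (Fin n) ℝ) (𝓕 : Matrix (Fin N × Fin m) (Fin N × Fin p) ℝ) :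
    Matrix (Fin N × Fin n) (Fin N × Fin n) ℝ :=
  (1 : Matrix (Fin N) (Fin N) ℝ) ⊗ₖ A +
    ((1 : Matrix (Fin N) (Fin N) ℝ) ⊗ₖ B) * 𝓕 * ((1 : Matrix (Fin N) (Fin N) ℝ) ⊗ₖ C)

/-- The leading block submatrix, obtained by deleting the last block row and block column:
it takes `𝓕^{(δ+1,↓)}` to `𝓕^{(δ,↓)}`. -/
def leading {δ : ℕ} (𝓕 : Matrix (Fin (δ + 1) × Fin m) (Fin (δ + 1) × Fin p) ℝ) :
    Matrix (Fin δ × Fin m) (Fin δ × Fin p) ℝ :=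
  𝓕.submatrix (Prod.map Fin.castSucc id) (Prod.map Fin.castSucc id)

/-- The block column with the blocks `I, 𝒜_LTI(𝓕^{(1,↓)}), …, 𝒜_LTI(𝓕^{(δ,↓)})`, built
recursively: the new last block is `[0 I] 𝒜_AUG^{(δ,↓)}` times the previous block column. -/
def stateColumn (A : Matrix (Fin n) (Fin n) ℝ) (B : Matrix (Fin n) (Fin m) ℝ)
    (C : Matrix (Fin p) (Fin n) ℝ) :
    (δ : ℕ) → Matrix (Fin δ × Fin m) (Fin δ × Fin p) ℝ → Matrix (Fin (δ + 1) × Fin n) (Fin n) ℝ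
  | 0, _ => Matrix.of fun r c => (1 : Matrix (Fin n) (Fin n) ℝ) r.2 c
  | δ + 1, 𝓕 => Matrix.of fun r c =>
      Fin.lastCases (motive := fun _ => ℝ)
        ((augMatrix A B C 𝓕 * stateColumn A B C δ (leading 𝓕)) (Fin.last δ, r.2) c)
        (fun i => stateColumn A B C δ (leading 𝓕) (i, r.2) c) r.1

/-- `𝒜_LTI(𝓕, Σ)` for `Σ = (A, B, C)`: the matrix with `x(k+N) = 𝒜_LTI x(k)` for `N ∣ k`.
State feedback is the case `C = I`. -/
def ltiMatrix (A : Matrix (Fin n) (Fin n) ℝ) (B : Matrix (Fin n) (Fin m) ℝ)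
    (C : Matrix (Fin p) (Fin n) ℝ) (𝓕 : Matrix (Fin N × Fin m) (Fin N × Fin p) ℝ) :
    Matrix (Fin n) (Fin n) ℝ :=
  Matrix.of fun i j => stateColumn A B C N 𝓕 (Fin.last N, i) j

/-! ### Sets of Lyapunov matrices -/

/-- `𝒫(𝒜) = {P ≻ 0 : 𝒜ᵀ P 𝒜 - P ≺ 0}`. -/
def lyapunovSet (𝒜 : Matrix (Fin n) (Fin n) ℝ) : Set (Matrix (Fin n) (Fin n) ℝ) :=
  {P | P.PosDef ∧ NegDef (𝒜.transpose * P * 𝒜 - P)}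

/-- The set of all stabilizing gain matrices `𝓕^{(N,↓)}`, that is, those with
`ρ(𝒜_LTI(𝓕^{(N,↓)}, Σ)) < 1`. The spectral radius of a real matrix is taken over `ℂ`. -/
def stabilizingGains (N : ℕ) (A : Matrix (Fin n) (Fin n) ℝ) (B : Matrix (Fin n) (Fin m) ℝ)
    (C : Matrix (Fin p) (Fin n) ℝ) : Set (Matrix (Fin N × Fin m) (Fin N × Fin p) ℝ) :=
  {𝓕 | (∃ F : ℕ → ℕ → Matrix (Fin m) (Fin p) ℝ, 𝓕 = gainMatrix N F) ∧
    spectralRadius ℂ ((ltiMatrix A B C 𝓕).map Complex.ofReal) < 1}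

/-- `𝒮^{(N)}(Σ)`: all Lyapunov matrices that correspond to stabilizing gains. -/
def lyapunovUnion (N : ℕ) (A : Matrix (Fin n) (Fin n) ℝ) (B : Matrix (Fin n) (Fin m) ℝ)
    (C : Matrix (Fin p) (Fin n) ℝ) : Set (Matrix (Fin n) (Fin n) ℝ) :=
  ⋃ 𝓕 ∈ stabilizingGains N A B C, lyapunovSet (ltiMatrix A B C 𝓕)

/-! ### The matrix inequalities -/

/-- `𝒳_δ(P, γ) = (-γ e_{(N+1,1)} e_{(N+1,1)}ᵀ + e_{(N+1,δ+1)} e_{(N+1,δ+1)}ᵀ) ⊗ P`. -/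
def matX (N δ : ℕ) (P : Matrix (Fin n) (Fin n) ℝ) (γ : ℝ) :
    Matrix (Fin (N + 1) × Fin n) (Fin (N + 1) × Fin n) ℝ :=
  (-(γ • Matrix.vecMulVec (unitVec (N + 1) 1) (unitVec (N + 1) 1)) +
    Matrix.vecMulVec (unitVec (N + 1) (δ + 1)) (unitVec (N + 1) (δ + 1))) ⊗ₖ P

/-- `Π_N`: the block row `[e_{(N,1)}ᵀ ⊗ I  0]` on top of `[I ⊗ A  I ⊗ B]`. -/
def matPi (N : ℕ) (A : Matrix (Fin n) (Fin n) ℝ) (B : Matrix (Fin n) (Fin m) ℝ) :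
    Matrix (Fin (N + 1) × Fin n) ((Fin N × Fin n) ⊕ (Fin N × Fin m)) ℝ :=
  Matrix.of fun r c =>
    Fin.cases (motive := fun _ => ℝ)
      (Matrix.fromCols
        ((Matrix.of fun (_ : Fin 1) j => unitVec N 1 j) ⊗ₖ (1 : Matrix (Fin n) (Fin n) ℝ))
        (0 : Matrix (Fin 1 × Fin n) (Fin N × Fin m) ℝ) (0, r.2) c)
      (fun i => Matrix.fromCols
        ((1 : Matrix (Fin N) (Fin N) ℝ) ⊗ₖ A) ((1 : Matrix (Fin N) (Fin N) ℝ) ⊗ₖ B) (i, r.2) c)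
      r.1

/-- The matrix `𝒞(𝓕)`. -/
def matC (A : Matrix (Fin n) (Fin n) ℝ) (B : Matrix (Fin n) (Fin m) ℝ)
    (C : Matrix (Fin p) (Fin n) ℝ) (𝓕 : Matrix (Fin N × Fin m) (Fin N × Fin p) ℝ) :
    Matrix ((Fin N × Fin m) ⊕ (Fin (N - 1) × Fin n)) ((Fin N × Fin n) ⊕ (Fin N × Fin m)) ℝ :=
  Matrix.fromBlocks
    (𝓕 * ((1 : Matrix (Fin N) (Fin N) ℝ) ⊗ₖ C))
    (-((1 : Matrix (Fin N) (Fin N) ℝ) ⊗ₖ (1 : Matrix (Fin m) (Fin m) ℝ)))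
    (matL (N - 1) N ⊗ₖ A - matR (N - 1) N ⊗ₖ (1 : Matrix (Fin n) (Fin n) ℝ))
    (matL (N - 1) N ⊗ₖ B)

/-- The matrix `ℋ(𝓕)`. -/
def matH (A : Matrix (Fin n) (Fin n) ℝ) (B : Matrix (Fin n) (Fin m) ℝ)
    (𝓕 : Matrix (Fin N × Fin m) (Fin N × Fin n) ℝ) :
    Matrix ((Fin N × Fin m) ⊕ (Fin (N - 1) × Fin n)) ((Fin N × Fin n) ⊕ (Fin N × Fin m)) ℝ :=
  Matrix.fromBlocks
    𝓕
    (-((1 : Matrix (Fin N) (Fin N) ℝ) ⊗ₖ (1 : Matrix (Fin m) (Fin m) ℝ)))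
    (matL (N - 1) N ⊗ₖ A - matR (N - 1) N ⊗ₖ (1 : Matrix (Fin n) (Fin n) ℝ))
    (matL (N - 1) N ⊗ₖ B)

/-- The block upper triangular matrix with blocks `G i j`, `i ≤ j`. -/
def blockUpper {a b : ℕ} (G : Fin N → Fin N → Matrix (Fin a) (Fin b) ℝ) :
    Matrix (Fin N × Fin a) (Fin N × Fin b) ℝ :=
  Matrix.of fun r c => if r.1 ≤ c.1 then G r.1 c.1 r.2 c.2 else 0

/-- `(P, 𝒥, 𝒢)` solves Ebihara's LMI (with `𝒢`, `𝒥` block upper triangular). -/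
def EbiharaLMI (A : Matrix (Fin n) (Fin n) ℝ) (B : Matrix (Fin n) (Fin m) ℝ)
    (P : Matrix (Fin n) (Fin n) ℝ) (J : Fin N → Fin N → Matrix (Fin m) (Fin n) ℝ)
    (G : Fin N → Fin N → Matrix (Fin n) (Fin n) ℝ) : Prop :=
  P.IsSymm ∧
  NegDef (matX N N P 1 + He (
    ((matL N (N + 1)).transpose ⊗ₖ A) * blockUpper G *
        (matR N (N + 1) ⊗ₖ (1 : Matrix (Fin n) (Fin n) ℝ))
      + ((matL N (N + 1)).transpose ⊗ₖ B) * blockUpper J *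
        (matR N (N + 1) ⊗ₖ (1 : Matrix (Fin n) (Fin n) ℝ))
      - ((matR N (N + 1)).transpose ⊗ₖ (1 : Matrix (Fin n) (Fin n) ℝ)) * blockUpper G *
        (matR N (N + 1) ⊗ₖ (1 : Matrix (Fin n) (Fin n) ℝ))))

/-- `𝓕_SF^{(N,↓)} = (T_N ⊗ I_m) 𝒥 𝒢⁻¹ (T_N ⊗ I_n)`. -/
noncomputable def sfGain (J : Fin N → Fin N → Matrix (Fin m) (Fin n) ℝ)
    (G : Fin N → Fin N → Matrix (Fin n) (Fin n) ℝ) :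
    Matrix (Fin N × Fin m) (Fin N × Fin n) ℝ :=
  (matT N ⊗ₖ (1 : Matrix (Fin m) (Fin m) ℝ)) * blockUpper J * (blockUpper G)⁻¹ *
    (matT N ⊗ₖ (1 : Matrix (Fin n) (Fin n) ℝ))

/-- The matrix inequalities `P ≻ 0` and
`Π_Nᵀ 𝒳_N(P,1) Π_N + He{ℋ(𝓕_SF)ᵀ 𝒱 𝒞(𝓕_SOF)} ≺ 0`. -/
def SynthesisBMI (A : Matrix (Fin n) (Fin n) ℝ) (B : Matrix (Fin n) (Fin m) ℝ)
    (C : Matrix (Fin p) (Fin n) ℝ) (𝓕SF : Matrix (Fin N × Fin m) (Fin N × Fin n) ℝ)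
    (P : Matrix (Fin n) (Fin n) ℝ)
    (𝒱 : Matrix ((Fin N × Fin m) ⊕ (Fin (N - 1) × Fin n))
      ((Fin N × Fin m) ⊕ (Fin (N - 1) × Fin n)) ℝ)
    (𝓕SOF : Matrix (Fin N × Fin m) (Fin N × Fin p) ℝ) : Prop :=
  P.PosDef ∧
  NegDef ((matPi N A B).transpose * matX N N P 1 * matPi N A B +
    He ((matH A B 𝓕SF).transpose * 𝒱 * matC A B C 𝓕SOF))

end PeriodicSOF

open PeriodicSOF

/-! A vector in the kernel of `matC A B C 𝓕` is one period of the closed loop: stacked states and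
inputs, determined by the initial state `x₀`. On it the form `Πᵀ 𝒳(P,1) Π` equals `x_Nᵀ P x_N - x₀ᵀ
P x₀` with `x_N = ltiMatrix A B C 𝓕 *ᵥ x₀` (`kernel_quadForm`). Negativity on this kernel is
therefore exactly the Lyapunov inequality for `P`. Since `matH` is `matC` with `C = 1`, the same
holds for the state feedback.

Feasibility: hypothesis (b) provides one `P` that serves both a stabilizing output feedback and
`Fhat`, so the form is negative on both kernels. The projection lemma `exists_multiplier` then
produces `V`. It needs `Fhat` to be causal, i.e. block lower triangular (`isBlockLower_sfGain`).

Stability: on the kernel of `matC` the multiplier term vanishes, which leaves the Lyapunov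
inequality and geometric decay of the state sampled once per period (`ltiAsympStable_of_lyapunov`).
States between samples are bounded by a fixed multiple of the last sample (`exists_norm_period_le`),
so the periodic system is stable too. -/

namespace PeriodicSOF

open Matrix Filter

/-! ### Comparison of quadratic forms -/

/-- Finsler's lemma for continuous homogeneous functions of degree two. -/
theorem exists_lt_mul_of_homogeneous {ι : Type*} [Fintype ι] {f g : (ι → ℝ) → ℝ}
    (hf : Continuous f) (hg : Continuous g)
    (hf2 : ∀ (c : ℝ) z, f (c • z) = c ^ 2 * f z) (hg2 : ∀ (c : ℝ) z, g (c • z) = c ^ 2 * g z)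
    (hf0 : ∀ z, 0 ≤ f z) (hfg : ∀ z, z ≠ 0 → f z = 0 → g z < 0) :
    ∃ ρ : ℝ, 1 ≤ ρ ∧ ∀ z, z ≠ 0 → g z < ρ * f z := by
  -- These open sets increase with `k` because `f ≥ 0`, so one of them contains the whole unit
  -- sphere; homogeneity extends the bound to all `z ≠ 0`. The shift `k + 1` ensures `1 ≤ ρ`.
  obtain ⟨k, hk⟩ := (isCompact_sphere (0 : ι → ℝ) 1).elim_directed_cover
    (fun k : ℕ => {z | g z < ((k : ℝ) + 1) * f z})
    (fun k => isOpen_lt hg (continuous_const.mul hf))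
    (by
      intro z hz
      have hz0 : z ≠ 0 := by
        rintro rfl
        simp at hz
      rw [Set.mem_iUnion]
      rcases (hf0 z).eq_or_lt with h | h
      · exact ⟨0, by simpa [← h] using hfg z hz0 h.symm⟩
      · obtain ⟨k, hk⟩ := exists_nat_gt (g z / f z)
        refine ⟨k, ?_⟩
        rw [div_lt_iff₀ h] at hk
        show g z < ((k : ℝ) + 1) * f z
        linarith)
    (by
      refine Monotone.directed_le fun a b hab z hz => ?_
      have : (a : ℝ) ≤ b := by exact_mod_cast hab
      exact lt_of_lt_of_le hz (mul_le_mul_of_nonneg_right (by linarith) (hf0 z)))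
  refine ⟨(k : ℝ) + 1, by linarith [(Nat.cast_nonneg k : (0 : ℝ) ≤ k)], fun z hz => ?_⟩
  have hn : 0 < ‖z‖ := norm_pos_iff.2 hz
  have hmem : ‖z‖⁻¹ • z ∈ Metric.sphere (0 : ι → ℝ) 1 := by
    simp [norm_smul, hn.ne']
  have h := hk hmem
  simp only [Set.mem_ofPred_eq, hf2, hg2] at h
  have hc : 0 < (‖z‖⁻¹) ^ 2 := by positivity
  refine lt_of_mul_lt_mul_left ?_ hc.le
  linarith

theorem continuous_quadForm {ι : Type*} [Fintype ι] (Q : Matrix ι ι ℝ) :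
    Continuous fun z : ι → ℝ => z ⬝ᵥ Q *ᵥ z := by
  simp only [dotProduct, mulVec]
  fun_prop

theorem quadForm_smul {ι : Type*} [Fintype ι] (Q : Matrix ι ι ℝ) (c : ℝ) (z : ι → ℝ) :
    (c • z) ⬝ᵥ Q *ᵥ (c • z) = c ^ 2 * (z ⬝ᵥ Q *ᵥ z) := by
  simp only [mulVec_smul, smul_dotProduct, dotProduct_smul, smul_eq_mul]
  ring

theorem dotProduct_mulVec_transpose {ι κ : Type*} [Fintype ι] [Fintype κ] (M : Matrix κ ι ℝ)
    (x : ι → ℝ) (y : κ → ℝ) : x ⬝ᵥ Mᵀ *ᵥ y = (M *ᵥ x) ⬝ᵥ y := by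
  rw [dotProduct_mulVec, vecMul_transpose]

theorem quadForm_congr {ι κ : Type*} [Fintype ι] [Fintype κ] (P : Matrix κ κ ℝ)
    (M : Matrix κ ι ℝ) (x : ι → ℝ) :
    x ⬝ᵥ (Mᵀ * P * M) *ᵥ x = (M *ᵥ x) ⬝ᵥ P *ᵥ (M *ᵥ x) := by
  rw [Matrix.mul_assoc, ← mulVec_mulVec, dotProduct_mulVec_transpose, ← mulVec_mulVec]

theorem quadForm_he {ι : Type*} [Fintype ι] (M : Matrix ι ι ℝ) (x : ι → ℝ) :
    x ⬝ᵥ He M *ᵥ x = 2 * (x ⬝ᵥ M *ᵥ x) := by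
  rw [He, add_mulVec, dotProduct_add, dotProduct_mulVec_transpose, dotProduct_comm (M *ᵥ x)]
  ring

theorem He.isSymm {ι : Type*} (M : Matrix ι ι ℝ) : (He M).IsSymm := by
  simp [He, Matrix.IsSymm, add_comm]

theorem negDef_iff {ι : Type*} [Fintype ι] {M : Matrix ι ι ℝ} :
    NegDef M ↔ M.IsSymm ∧ ∀ x, x ≠ 0 → x ⬝ᵥ M *ᵥ x < 0 := by
  rw [NegDef, posDef_iff_dotProduct_mulVec]
  simp [Matrix.IsHermitian, Matrix.IsSymm, neg_mulVec, conjTranspose_eq_transpose_of_trivial]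

theorem posDef_iff_quadForm {ι : Type*} [Fintype ι] {M : Matrix ι ι ℝ} :
    M.PosDef ↔ M.IsSymm ∧ ∀ x, x ≠ 0 → 0 < x ⬝ᵥ M *ᵥ x := by
  rw [posDef_iff_dotProduct_mulVec]
  simp [Matrix.IsHermitian, Matrix.IsSymm, conjTranspose_eq_transpose_of_trivial]

/-! ### The projection lemma -/

theorem exists_comp_eq_of_ker_le {K V W U : Type*} [Field K] [AddCommGroup V] [Module K V]
    [AddCommGroup W] [Module K W] [AddCommGroup U] [Module K U]
    (f : V →ₗ[K] W) (g : V →ₗ[K] U) (h : LinearMap.ker f ≤ LinearMap.ker g) :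
    ∃ k : W →ₗ[K] U, k ∘ₗ f = g := by
  obtain ⟨k, hk⟩ := LinearMap.exists_extend
    (((LinearMap.ker f).liftQ g h) ∘ₗ f.quotKerEquivRange.symm.toLinearMap)
  refine ⟨k, LinearMap.ext fun v => ?_⟩
  have := LinearMap.congr_fun hk (f.quotKerEquivRange (Submodule.Quotient.mk v))
  simpa using this

/-- A large penalty `ρ` on leaving the kernel of `H` dominates `Q`; for symmetric `Q` this makes `ρ
HᵀH - Q` positive definite. -/
theorem finsler {ι κ : Type*} [Fintype ι] [Fintype κ] (Q : Matrix ι ι ℝ) (H : Matrix κ ι ℝ)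
    (hQ : ∀ z, z ≠ 0 → H *ᵥ z = 0 → z ⬝ᵥ Q *ᵥ z < 0) :
    ∃ ρ : ℝ, 1 ≤ ρ ∧ ∀ z, z ≠ 0 → z ⬝ᵥ Q *ᵥ z < ρ * ((H *ᵥ z) ⬝ᵥ (H *ᵥ z)) := by
  refine exists_lt_mul_of_homogeneous ?_ (continuous_quadForm Q) ?_ (quadForm_smul Q)
    (fun z => ?_) (fun z hz h => ?_)
  · simp only [dotProduct, mulVec]
    fun_prop
  · intro c z
    simp only [mulVec_smul, smul_dotProduct, dotProduct_smul, smul_eq_mul]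
    ring
  · exact Finset.sum_nonneg fun i _ => mul_self_nonneg _
  · exact hQ z hz (dotProduct_self_eq_zero.1 h)

/-- The projection (elimination) lemma. -/
theorem exists_multiplier {ι κ μ : Type*} [Fintype ι] [DecidableEq ι] [Fintype κ] [DecidableEq κ]
    [Fintype μ] [DecidableEq μ]
    {Q : Matrix ι ι ℝ} (hQ : Q.IsSymm) (H : Matrix κ ι ℝ) (C : Matrix μ ι ℝ)
    (hH : ∀ z, z ≠ 0 → H *ᵥ z = 0 → z ⬝ᵥ Q *ᵥ z < 0)
    (hC : ∀ z, z ≠ 0 → C *ᵥ z = 0 → z ⬝ᵥ Q *ᵥ z < 0) :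
    ∃ V : Matrix κ μ ℝ, NegDef (Q + He (Hᵀ * V * C)) := by
  obtain ⟨ρ, hρ1, hρ⟩ := finsler Q H hH
  set S : Matrix ι ι ℝ := ρ • (Hᵀ * H) - Q with hS
  have hSsymm : Sᵀ = S := by
    simp [hS, transpose_sub, transpose_smul, transpose_mul, hQ.eq]
  have hSxy : ∀ x y, x ⬝ᵥ S *ᵥ y = ρ * ((H *ᵥ x) ⬝ᵥ (H *ᵥ y)) - x ⬝ᵥ Q *ᵥ y := by
    intro x y
    rw [hS, sub_mulVec, smul_mulVec, dotProduct_sub, dotProduct_smul, ← mulVec_mulVec,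
      dotProduct_mulVec_transpose, smul_eq_mul]
  set β : LinearMap.BilinForm ℝ (ι → ℝ) := Matrix.toBilin' S with hβ
  have hβxy : ∀ x y, β x y = x ⬝ᵥ S *ᵥ y := fun x y => by
    rw [hβ, Matrix.toBilin'_apply']
  have hrefl : β.IsRefl := by
    intro x y h
    rw [hβxy] at h ⊢
    rw [← h, ← hSsymm, dotProduct_mulVec_transpose, dotProduct_comm, hSsymm]
  -- `S` is positive definite, so the kernel of `C` and its `S`-orthogonal complement split the
  -- space; `pb` is the projection onto the complement.
  set W : Submodule ℝ (ι → ℝ) := LinearMap.ker C.mulVecLin with hW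
  have hcompl : IsCompl W (β.orthogonal W) := by
    rw [LinearMap.BilinForm.isCompl_orthogonal_iff_disjoint hrefl, Submodule.disjoint_def]
    intro x hx hx'
    by_contra hx0
    have h0 : β x x = 0 := hx' x hx
    rw [hβxy, hSxy] at h0
    linarith [hρ x hx0]
  set pb : (ι → ℝ) →ₗ[ℝ] (ι → ℝ) :=
    (β.orthogonal W).subtype ∘ₗ Submodule.projectionOnto _ _ hcompl.symm with hpb
  have hpb_mem : ∀ z, pb z ∈ β.orthogonal W := fun z => Subtype.property _
  have hpa_mem : ∀ z, z - pb z ∈ W := by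
    intro z
    rw [← Submodule.ker_projectionOnto hcompl.symm, LinearMap.mem_ker, map_sub, sub_eq_zero]
    exact (Submodule.projectionOnto_apply_left hcompl.symm _).symm
  -- The multiplier is fixed by `V C z = -ρ H (pb z)`, which is consistent because `pb` vanishes on
  -- the kernel of `C`.
  obtain ⟨v, hv⟩ := exists_comp_eq_of_ker_le C.mulVecLin ((-ρ) • (H.mulVecLin ∘ₗ pb)) (by
    intro z hz
    have : pb z = 0 := by
      rw [hpb, LinearMap.comp_apply,
        (Submodule.projectionOnto_apply_eq_zero_iff hcompl.symm).2 hz]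
      rfl
    simp [this])
  refine ⟨LinearMap.toMatrix' v, negDef_iff.2 ⟨hQ.add (He.isSymm _), fun z hz => ?_⟩⟩
  have hVz : LinearMap.toMatrix' v *ᵥ (C *ᵥ z) = (-ρ) • (H *ᵥ pb z) := by
    have := LinearMap.congr_fun hv z
    rw [← Matrix.toLin'_apply (LinearMap.toMatrix' v), Matrix.toLin'_toMatrix']
    simpa using this
  rw [add_mulVec, dotProduct_add, quadForm_he, Matrix.mul_assoc, ← mulVec_mulVec,
    dotProduct_mulVec_transpose, ← mulVec_mulVec, hVz, dotProduct_smul, smul_eq_mul]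
  obtain ⟨a, b, rfl, ha, hb, hb'⟩ : ∃ a b, z = a + b ∧ a ∈ W ∧ b ∈ β.orthogonal W ∧ pb z = b :=
    ⟨z - pb z, pb z, by abel, hpa_mem z, hpb_mem z, rfl⟩
  rw [hb']
  -- Orthogonality reads `ρ (Ha)·(Hb) = aᵀQb`, so the cross terms cancel and `aᵀQa + bᵀQb - 2ρ|Hb|²`
  -- remains. Here `hC` handles `a` and the choice of `ρ` handles `b`.
  have hab : β a b = 0 := hb a ha
  rw [hβxy, hSxy] at hab
  have hba : b ⬝ᵥ Q *ᵥ a = a ⬝ᵥ Q *ᵥ b := by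
    conv_lhs => rw [← hQ.eq, dotProduct_mulVec_transpose, dotProduct_comm]
  have hCa : C *ᵥ a = 0 := by simpa [hW] using ha
  simp only [mulVec_add, dotProduct_add, add_dotProduct, hba]
  have hb2 : 0 ≤ (H *ᵥ b) ⬝ᵥ (H *ᵥ b) := Finset.sum_nonneg fun i _ => mul_self_nonneg _
  have hρb : 0 ≤ ρ * ((H *ᵥ b) ⬝ᵥ (H *ᵥ b)) := mul_nonneg (by linarith) hb2
  by_cases ha0 : a = 0
  · subst ha0
    have hb0 : b ≠ 0 := by simpa using hz
    have := hρ b hb0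
    simp
    nlinarith
  · have h1 := hC a ha0 hCa
    by_cases hb0 : b = 0
    · subst hb0
      simpa using h1
    · have := hρ b hb0
      nlinarith

/-! ### The discrete-time Lyapunov inequality -/

theorem exists_quadForm_le_norm_sq {ι : Type*} [Fintype ι] (P : Matrix ι ι ℝ) :
    ∃ ρ : ℝ, 1 ≤ ρ ∧ ∀ z, z ⬝ᵥ P *ᵥ z ≤ ρ * ‖z‖ ^ 2 := by
  obtain ⟨ρ, h1, h⟩ := exists_lt_mul_of_homogeneous (f := fun z : ι → ℝ => ‖z‖ ^ 2)
    (by fun_prop) (continuous_quadForm P)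
    (fun c z => by simp [norm_smul, mul_pow]) (quadForm_smul P) (fun z => by positivity)
    (fun z hz h => absurd h (by simpa using hz))
  refine ⟨ρ, h1, fun z => ?_⟩
  by_cases hz : z = 0
  · simp [hz]
  · exact (h z hz).le

/-- A definite form vanishes only at `0`, so the comparison has no kernel to check. It is applied
with `g` the squared norm and with `g` the Lyapunov function. -/
theorem exists_le_mul_of_pos {ι : Type*} [Fintype ι] (S : Matrix ι ι ℝ)
    (hS : ∀ z, z ≠ 0 → 0 < z ⬝ᵥ S *ᵥ z) {g : (ι → ℝ) → ℝ} (hg : Continuous g)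
    (hg2 : ∀ (c : ℝ) z, g (c • z) = c ^ 2 * g z) :
    ∃ ρ : ℝ, 1 ≤ ρ ∧ ∀ z, g z ≤ ρ * (z ⬝ᵥ S *ᵥ z) := by
  obtain ⟨ρ, h1, h⟩ := exists_lt_mul_of_homogeneous (continuous_quadForm S) hg
    (quadForm_smul S) hg2
    (fun z => by
      by_cases hz : z = 0
      · simp [hz]
      · exact (hS z hz).le)
    (fun z hz h => absurd h (hS z hz).ne')
  refine ⟨ρ, h1, fun z => ?_⟩
  by_cases hz : z = 0
  · have := hg2 0 0
    simp_all
  · exact (h z hz).le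

/-- A solution of the discrete-time Lyapunov inequality certifies asymptotic stability. -/
theorem ltiAsympStable_of_lyapunov {n : ℕ} {P 𝒜 : Matrix (Fin n) (Fin n) ℝ} (hP : P.PosDef)
    (h : ∀ x, x ≠ 0 → (𝒜 *ᵥ x) ⬝ᵥ P *ᵥ (𝒜 *ᵥ x) < x ⬝ᵥ P *ᵥ x) : LTIAsympStable 𝒜 := by
  have hPpos := (posDef_iff_quadForm.1 hP).2
  obtain ⟨a, ha1, ha⟩ := exists_quadForm_le_norm_sq P
  obtain ⟨b, hb1, hb⟩ := exists_le_mul_of_pos P hPpos (g := fun z => ‖z‖ ^ 2) (by fun_prop)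
    (fun c z => by simp [norm_smul, mul_pow])
  have hS : ∀ z, z ⬝ᵥ (P - 𝒜ᵀ * P * 𝒜) *ᵥ z
      = z ⬝ᵥ P *ᵥ z - (𝒜 *ᵥ z) ⬝ᵥ P *ᵥ (𝒜 *ᵥ z) := fun z => by
    rw [sub_mulVec, dotProduct_sub, quadForm_congr]
  obtain ⟨c, hc1, hc⟩ := exists_le_mul_of_pos (P - 𝒜ᵀ * P * 𝒜)
    (fun z hz => by rw [hS]; linarith [h z hz]) (continuous_quadForm P) (quadForm_smul P)
  have hc0 : 0 < c := by linarith
  -- With `V z = zᵀPz`, the bound `V z ≤ c (V z - V (𝒜 z))` rearranges to `V (𝒜 z) ≤ r V z`; `1 ≤ c`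
  -- gives `0 ≤ r`.
  set r : ℝ := 1 - 1 / c with hr
  have hr0 : 0 ≤ r := by
    rw [hr, sub_nonneg, div_le_one hc0]
    exact hc1
  have hr1 : r < 1 := by
    rw [hr]
    linarith [div_pos one_pos hc0]
  have hstep : ∀ z, (𝒜 *ᵥ z) ⬝ᵥ P *ᵥ (𝒜 *ᵥ z) ≤ r * (z ⬝ᵥ P *ᵥ z) := by
    intro z
    have h1 := hc z
    rw [hS, ← div_le_iff₀' hc0] at h1
    rw [hr, sub_mul, one_mul, one_div_mul_eq_div]
    linarith
  have hbound : ∀ φ : ℕ → Fin n → ℝ, (∀ t, φ (t + 1) = 𝒜 *ᵥ φ t) →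
      ∀ t, ‖φ t‖ ^ 2 ≤ b * a * r ^ t * ‖φ 0‖ ^ 2 := by
    intro φ hφ t
    have hV : φ t ⬝ᵥ P *ᵥ φ t ≤ r ^ t * (φ 0 ⬝ᵥ P *ᵥ φ 0) := by
      induction t with
      | zero => simp
      | succ t ih =>
        rw [hφ, pow_succ' r, mul_assoc]
        exact (hstep _).trans (mul_le_mul_of_nonneg_left ih hr0)
    calc ‖φ t‖ ^ 2 ≤ b * (φ t ⬝ᵥ P *ᵥ φ t) := hb _
      _ ≤ b * (r ^ t * (a * ‖φ 0‖ ^ 2)) := by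
          refine mul_le_mul_of_nonneg_left (hV.trans ?_) (by linarith)
          exact mul_le_mul_of_nonneg_left (ha _) (pow_nonneg hr0 t)
      _ = b * a * r ^ t * ‖φ 0‖ ^ 2 := by ring
  have hba : 0 < b * a := by nlinarith
  refine ⟨fun ε hε => ⟨ε / Real.sqrt (b * a), by positivity, fun φ hφ h0 t => ?_⟩, fun φ hφ => ?_⟩
  · refine lt_of_pow_lt_pow_left₀ 2 hε.le ((hbound φ hφ t).trans_lt ?_)
    have h2 : ‖φ 0‖ ^ 2 < (ε / Real.sqrt (b * a)) ^ 2 :=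
      pow_lt_pow_left₀ h0 (norm_nonneg _) two_ne_zero
    rw [div_pow, Real.sq_sqrt hba.le, lt_div_iff₀' hba] at h2
    have h3 : r ^ t ≤ 1 := pow_le_one₀ hr0 hr1.le
    have h4 : b * a * r ^ t * ‖φ 0‖ ^ 2 ≤ b * a * ‖φ 0‖ ^ 2 := by
      refine mul_le_mul_of_nonneg_right ?_ (by positivity)
      exact mul_le_of_le_one_right hba.le h3
    linarith
  · rw [tendsto_zero_iff_norm_tendsto_zero]
    have h1 : Tendsto (fun t => b * a * r ^ t * ‖φ 0‖ ^ 2) atTop (𝓝 0) := by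
      simpa using ((tendsto_pow_atTop_nhds_zero_of_lt_one hr0 hr1).const_mul (b * a)).mul_const
        (‖φ 0‖ ^ 2)
    have h2 := squeeze_zero (fun t => sq_nonneg ‖φ t‖) (hbound φ hφ) h1
    simpa using h2.sqrt

variable {n m p N : ℕ}

/-! ### Block structure -/

/-- The matrix is block lower triangular. -/
def IsBlockLower (𝓕 : Matrix (Fin N × Fin m) (Fin N × Fin p) ℝ) : Prop :=
  ∀ r c, r.1 < c.1 → 𝓕 r c = 0

theorem kronecker_mulVec_apply {ι κ a b : Type*} [Fintype κ] [Fintype b] (M : Matrix ι κ ℝ)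
    (A : Matrix a b ℝ) (X : κ × b → ℝ) (i : ι) (s : a) :
    ((M ⊗ₖ A) *ᵥ X) (i, s) = ∑ j, M i j * (A *ᵥ fun t => X (j, t)) s := by
  simp only [mulVec, dotProduct, Fintype.sum_prod_type, kroneckerMap_apply, Finset.mul_sum,
    mul_assoc]

theorem one_kronecker_mulVec_apply {a b : Type*} [Fintype b]
    (A : Matrix a b ℝ) (X : Fin N × b → ℝ) (i : Fin N) (s : a) :
    (((1 : Matrix (Fin N) (Fin N) ℝ) ⊗ₖ A) *ᵥ X) (i, s) = (A *ᵥ fun t => X (i, t)) s := by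
  rw [kronecker_mulVec_apply]
  simp [Matrix.one_apply]

theorem sum_matL_mul {M : ℕ} (i : Fin M) (f : Fin (M + 1) → ℝ) :
    ∑ j, matL M (M + 1) i j * f j = f i.castSucc := by
  rw [Finset.sum_eq_single i.castSucc]
  · simp [matL]
  · intro j _ hj
    have : (j : ℕ) ≠ i := fun h => hj (Fin.ext h)
    simp [matL, this]
  · simp

theorem sum_matR_mul {M : ℕ} (i : Fin M) (f : Fin (M + 1) → ℝ) :
    ∑ j, matR M (M + 1) i j * f j = f i.succ := by
  rw [Finset.sum_eq_single i.succ]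
  · simp [matR]
  · intro j _ hj
    have : (j : ℕ) ≠ i + 1 := fun h => hj (Fin.ext h)
    simp [matR, this]
  · simp

theorem augMatrix_mulVec_apply (A : Matrix (Fin n) (Fin n) ℝ) (B : Matrix (Fin n) (Fin m) ℝ)
    (C : Matrix (Fin p) (Fin n) ℝ) (𝓕 : Matrix (Fin N × Fin m) (Fin N × Fin p) ℝ)
    (X : Fin N × Fin n → ℝ) (k : Fin N) (a : Fin n) :
    (augMatrix A B C 𝓕 *ᵥ X) (k, a) = (A *ᵥ fun t => X (k, t)) a +
      (B *ᵥ fun b => (𝓕 *ᵥ fun q => (C *ᵥ fun t => X (q.1, t)) q.2) (k, b)) a := by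
  have h : ((1 : Matrix (Fin N) (Fin N) ℝ) ⊗ₖ C) *ᵥ X =
      fun q => (C *ᵥ fun t => X (q.1, t)) q.2 :=
    funext fun q => one_kronecker_mulVec_apply C X q.1 q.2
  rw [augMatrix, add_mulVec, Pi.add_apply, one_kronecker_mulVec_apply, Matrix.mul_assoc,
    ← mulVec_mulVec, one_kronecker_mulVec_apply, ← mulVec_mulVec, h]

theorem IsBlockLower.leading {δ : ℕ} {𝓕 : Matrix (Fin (δ + 1) × Fin m) (Fin (δ + 1) × Fin p) ℝ}
    (h : IsBlockLower 𝓕) : IsBlockLower (leading 𝓕) := fun r c hrc =>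
  h _ _ (by simpa using hrc)

/-- Causality: earlier inputs do not see the last output, so truncating the gain leaves them
unchanged. -/
theorem leading_mulVec_apply {δ : ℕ} {𝓕 : Matrix (Fin (δ + 1) × Fin m) (Fin (δ + 1) × Fin p) ℝ}
    (h : IsBlockLower 𝓕) (Y : Fin (δ + 1) × Fin p → ℝ) (k : Fin δ) (a : Fin m) :
    (leading 𝓕 *ᵥ fun q => Y (q.1.castSucc, q.2)) (k, a) = (𝓕 *ᵥ Y) (k.castSucc, a) := by
  have h0 : ∀ c, 𝓕 (k.castSucc, a) (Fin.last δ, c) = 0 := fun c =>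
    h _ _ (Fin.castSucc_lt_last k)
  simp [mulVec, dotProduct, Fintype.sum_prod_type, Fin.sum_univ_castSucc, PeriodicSOF.leading, h0]

theorem IsBlockLower.mulVec_congr {𝓕 : Matrix (Fin N × Fin m) (Fin N × Fin p) ℝ}
    (h : IsBlockLower 𝓕) {Y Z : Fin N × Fin p → ℝ} {k : Fin N}
    (hYZ : ∀ q, q.1 ≤ k → Y q = Z q) (a : Fin m) : (𝓕 *ᵥ Y) (k, a) = (𝓕 *ᵥ Z) (k, a) := by
  refine Finset.sum_congr rfl fun q _ => ?_
  rcases le_or_gt q.1 k with hq | hq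
  · rw [hYZ q hq]
  · show 𝓕 (k, a) q * Y q = 𝓕 (k, a) q * Z q
    rw [h (k, a) q hq, zero_mul, zero_mul]

/-- The closed-loop recursion over one period. -/
def closedLoop (A : Matrix (Fin n) (Fin n) ℝ) (B : Matrix (Fin n) (Fin m) ℝ)
    (C : Matrix (Fin p) (Fin n) ℝ) (𝓕 : Matrix (Fin N × Fin m) (Fin N × Fin p) ℝ)
    (x : ℕ → Fin n → ℝ) (k : Fin N) : Fin n → ℝ :=
  A *ᵥ x k + B *ᵥ fun b => (𝓕 *ᵥ fun q => (C *ᵥ x q.1) q.2) (k, b)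

/-- The block column of `stateColumn` generates the solution of the closed-loop recursion. -/
theorem stateColumn_mulVec (A : Matrix (Fin n) (Fin n) ℝ) (B : Matrix (Fin n) (Fin m) ℝ)
    (C : Matrix (Fin p) (Fin n) ℝ) : ∀ (δ : ℕ) (𝓕 : Matrix (Fin δ × Fin m) (Fin δ × Fin p) ℝ)
    (_ : IsBlockLower 𝓕) (x : ℕ → Fin n → ℝ)
    (_ : ∀ k : Fin δ, x (k + 1) = closedLoop A B C 𝓕 x k),
    stateColumn A B C δ 𝓕 *ᵥ x 0 = fun r => x r.1 r.2
  | 0, 𝓕, _, x, _ => by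
    funext ⟨j, a⟩
    have hj : j = 0 := Fin.ext (by omega)
    subst hj
    have : (stateColumn A B C 0 𝓕 *ᵥ x 0) (0, a) = ((1 : Matrix (Fin n) (Fin n) ℝ) *ᵥ x 0) a := rfl
    rw [this, one_mulVec]
    rfl
  | δ + 1, 𝓕, h, x, hx => by
    -- By causality `x` also solves the recursion of the truncated gain, so the shorter column
    -- applies.
    have ih : stateColumn A B C δ (leading 𝓕) *ᵥ x 0 = fun r => x r.1 r.2 := by
      refine stateColumn_mulVec A B C δ (leading 𝓕) h.leading x fun k => ?_
      have := hx k.castSucc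
      rw [Fin.val_castSucc] at this
      rw [this, closedLoop, closedLoop, Fin.val_castSucc]
      congr 2
      funext b
      exact (leading_mulVec_apply h (fun q => (C *ᵥ x q.1) q.2) k b).symm
    funext ⟨j, a⟩
    induction j using Fin.lastCases with
    | last =>
      have : (stateColumn A B C (δ + 1) 𝓕 *ᵥ x 0) (Fin.last (δ + 1), a) =
          ((augMatrix A B C 𝓕 * stateColumn A B C δ (leading 𝓕)) *ᵥ x 0) (Fin.last δ, a) := by
        simp [mulVec, stateColumn]
      rw [this, ← mulVec_mulVec, ih, augMatrix_mulVec_apply]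
      have hl := hx (Fin.last δ)
      simp only [Fin.val_last] at hl ⊢
      rw [hl, closedLoop]
      rfl
    | cast i =>
      have : (stateColumn A B C (δ + 1) 𝓕 *ᵥ x 0) (i.castSucc, a) =
          (stateColumn A B C δ (leading 𝓕) *ᵥ x 0) (i, a) := by
        simp [mulVec, stateColumn]
      rw [this, ih]
      rfl

theorem ltiMatrix_mulVec {A : Matrix (Fin n) (Fin n) ℝ} {B : Matrix (Fin n) (Fin m) ℝ}
    {C : Matrix (Fin p) (Fin n) ℝ} {𝓕 : Matrix (Fin N × Fin m) (Fin N × Fin p) ℝ}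
    (h𝓕 : IsBlockLower 𝓕) {x : ℕ → Fin n → ℝ}
    (hx : ∀ k : Fin N, x (k + 1) = closedLoop A B C 𝓕 x k) :
    ltiMatrix A B C 𝓕 *ᵥ x 0 = x N := by
  funext a
  exact congrFun (stateColumn_mulVec A B C N 𝓕 h𝓕 x hx) (Fin.last N, a)

/-- `closedLoop` formally reads all `N` states, so it is not literally a recursion. The solution is
built one state at a time; causality keeps the equations already satisfied intact when `x (K + 1)`
is overwritten. -/
theorem exists_closedLoop (A : Matrix (Fin n) (Fin n) ℝ) (B : Matrix (Fin n) (Fin m) ℝ)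
    (C : Matrix (Fin p) (Fin n) ℝ) {𝓕 : Matrix (Fin N × Fin m) (Fin N × Fin p) ℝ}
    (h𝓕 : IsBlockLower 𝓕) (x₀ : Fin n → ℝ) :
    ∃ x : ℕ → Fin n → ℝ, x 0 = x₀ ∧ ∀ k : Fin N, x (k + 1) = closedLoop A B C 𝓕 x k := by
  suffices h : ∀ K ≤ N, ∃ x : ℕ → Fin n → ℝ, x 0 = x₀ ∧
      ∀ k : Fin N, (k : ℕ) < K → x (k + 1) = closedLoop A B C 𝓕 x k by
    obtain ⟨x, h0, h⟩ := h N le_rfl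
    exact ⟨x, h0, fun k => h k k.2⟩
  intro K
  induction K with
  | zero => exact fun _ => ⟨fun _ => x₀, rfl, fun k hk => absurd hk (Nat.not_lt_zero _)⟩
  | succ K ih =>
    intro hK
    obtain ⟨x, h0, h⟩ := ih (by omega)
    refine ⟨Function.update x (K + 1) (closedLoop A B C 𝓕 x ⟨K, hK⟩), by simpa using h0,
      fun k hk => ?_⟩
    have hcongr : ∀ v, closedLoop A B C 𝓕 (Function.update x (K + 1) v) k =
        closedLoop A B C 𝓕 x k := by
      intro v
      have hu : ∀ j : ℕ, j ≤ k → Function.update x (K + 1) v j = x j := fun j hj =>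
        Function.update_of_ne (by omega) _ _
      unfold closedLoop
      rw [hu k le_rfl]
      congr 2
      funext b
      exact h𝓕.mulVec_congr (fun q hq => by rw [hu q.1 hq]) b
    rw [hcongr]
    rcases Nat.lt_succ_iff_lt_or_eq.1 hk with hk' | hk'
    · rw [Function.update_of_ne (by omega), h k hk']
    · subst hk'
      simp

/-! ### The kernel of `𝒞(𝓕)` and the quadratic form on it -/

theorem matH_eq_matC (A : Matrix (Fin n) (Fin n) ℝ) (B : Matrix (Fin n) (Fin m) ℝ)
    (𝓕 : Matrix (Fin N × Fin m) (Fin N × Fin n) ℝ) : matH A B 𝓕 = matC A B 1 𝓕 := by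
  simp [matH, matC]

/-- The first block row of `matC` is the control law, the second the `M = N - 1` plant steps between
the stacked states. The `N`-th plant step is left to `matPi`. -/
theorem matC_mulVec_eq_zero_iff {M : ℕ} (A : Matrix (Fin n) (Fin n) ℝ)
    (B : Matrix (Fin n) (Fin m) ℝ) (C : Matrix (Fin p) (Fin n) ℝ)
    (𝓕 : Matrix (Fin (M + 1) × Fin m) (Fin (M + 1) × Fin p) ℝ)
    (X : Fin (M + 1) × Fin n → ℝ) (U : Fin (M + 1) × Fin m → ℝ) :
    matC A B C 𝓕 *ᵥ Sum.elim X U = 0 ↔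
      (U = 𝓕 *ᵥ fun q => (C *ᵥ fun t => X (q.1, t)) q.2) ∧
      ∀ i : Fin M, (fun t => X (i.succ, t)) =
        (A *ᵥ fun t => X (i.castSucc, t)) + B *ᵥ fun b => U (i.castSucc, b) := by
  have h : ((1 : Matrix (Fin (M + 1)) (Fin (M + 1)) ℝ) ⊗ₖ C) *ᵥ X =
      fun q => (C *ᵥ fun t => X (q.1, t)) q.2 :=
    funext fun q => one_kronecker_mulVec_apply C X q.1 q.2
  have h2 : ∀ (i : Fin M) (a : Fin n),
      ((matL M (M + 1) ⊗ₖ A - matR M (M + 1) ⊗ₖ (1 : Matrix (Fin n) (Fin n) ℝ)) *ᵥ X +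
        (matL M (M + 1) ⊗ₖ B) *ᵥ U) (i, a) =
      (A *ᵥ fun t => X (i.castSucc, t)) a - X (i.succ, a) +
        (B *ᵥ fun b => U (i.castSucc, b)) a := by
    intro i a
    simp only [Pi.add_apply, sub_mulVec, Pi.sub_apply, kronecker_mulVec_apply,
      one_mulVec]
    rw [sum_matL_mul i fun j => (A *ᵥ fun t => X (j, t)) a, sum_matR_mul i fun j => X (j, a),
      sum_matL_mul i fun j => (B *ᵥ fun t => U (j, t)) a]
  rw [matC, fromBlocks_mulVec]
  simp only [Sum.elim_comp_inl, Sum.elim_comp_inr]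
  rw [← Sum.elim_zero_zero, Sum.elim_eq_iff, ← mulVec_mulVec, h, one_kronecker_one, neg_mulVec,
    one_mulVec]
  refine and_congr ?_ ?_
  · rw [← sub_eq_add_neg, sub_eq_zero, eq_comm]
  · constructor
    · intro h0 i
      funext a
      have := (h2 i a).symm.trans (congrFun h0 (i, a))
      simp only [Pi.zero_apply, Pi.add_apply] at this ⊢
      linarith
    · intro h0
      funext ⟨i, a⟩
      refine (h2 i a).trans ?_
      have := congrFun (h0 i) a
      simp only [Pi.zero_apply, Pi.add_apply] at this ⊢
      linarith

/-- This is the factorization `uuᵀ ⊗ P = (u ⊗ I) P (uᵀ ⊗ I)`. -/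
theorem quadForm_vecMulVec_kronecker {ι : Type*} [Fintype ι] (u : ι → ℝ)
    (P : Matrix (Fin n) (Fin n) ℝ) (Y : ι × Fin n → ℝ) :
    Y ⬝ᵥ (vecMulVec u u ⊗ₖ P) *ᵥ Y =
      (∑ i, u i • fun t => Y (i, t)) ⬝ᵥ P *ᵥ (∑ i, u i • fun t => Y (i, t)) := by
  have : ∀ i s, ((vecMulVec u u ⊗ₖ P) *ᵥ Y) (i, s) =
      u i * (P *ᵥ (∑ i, u i • fun t => Y (i, t))) s := by
    intro i s
    rw [kronecker_mulVec_apply, mulVec_sum, Finset.sum_apply, Finset.mul_sum]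
    refine Finset.sum_congr rfl fun j _ => ?_
    rw [mulVec_smul, vecMulVec_apply, Pi.smul_apply, smul_eq_mul, mul_assoc]
  simp only [dotProduct, Fintype.sum_prod_type, this]
  rw [Finset.sum_comm]
  simp only [Finset.sum_apply, Finset.sum_mul, Pi.smul_apply, smul_eq_mul]
  refine Finset.sum_congr rfl fun s _ => Finset.sum_congr rfl fun i _ => by ring

theorem quadForm_matX (P : Matrix (Fin n) (Fin n) ℝ) (Y : Fin (N + 1) × Fin n → ℝ) :
    Y ⬝ᵥ matX N N P 1 *ᵥ Y =
      -((fun t => Y (0, t)) ⬝ᵥ P *ᵥ fun t => Y (0, t)) +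
        (fun t => Y (Fin.last N, t)) ⬝ᵥ P *ᵥ fun t => Y (Fin.last N, t) := by
  have hu : ∀ k : Fin (N + 1),
      (∑ i, unitVec (N + 1) (k + 1) i • fun t => Y (i, t)) = fun t => Y (k, t) := by
    intro k
    rw [Finset.sum_eq_single k]
    · simp [unitVec]
    · intro j _ hj
      have : (j : ℕ) ≠ k := fun h => hj (Fin.ext h)
      simp [unitVec, this]
    · simp
  have h0 := hu 0
  have hN := hu (Fin.last N)
  simp only [Fin.val_zero, Fin.val_last, zero_add] at h0 hN
  rw [matX, one_smul, Matrix.add_kronecker, add_mulVec, dotProduct_add,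
    quadForm_vecMulVec_kronecker, hN, ← neg_one_smul ℝ (vecMulVec _ _), smul_kronecker,
    smul_mulVec, dotProduct_smul, quadForm_vecMulVec_kronecker, h0]
  simp

theorem matX_isSymm {P : Matrix (Fin n) (Fin n) ℝ} (hP : P.IsSymm) (N : ℕ) :
    (matX N N P 1).IsSymm := by
  rw [Matrix.IsSymm, matX, ← kroneckerMap_transpose, hP.eq]
  simp [transpose_add, transpose_neg, transpose_vecMulVec]

theorem matPi_mulVec_zero {M : ℕ} (A : Matrix (Fin n) (Fin n) ℝ) (B : Matrix (Fin n) (Fin m) ℝ)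
    (X : Fin (M + 1) × Fin n → ℝ) (U : Fin (M + 1) × Fin m → ℝ) :
    (fun a => (matPi (M + 1) A B *ᵥ Sum.elim X U) (0, a)) = fun a => X (0, a) := by
  funext a
  have : (matPi (M + 1) A B *ᵥ Sum.elim X U) (0, a) =
      (fromCols ((Matrix.of fun (_ : Fin 1) j => unitVec (M + 1) 1 j) ⊗ₖ
        (1 : Matrix (Fin n) (Fin n) ℝ)) (0 : Matrix (Fin 1 × Fin n) (Fin (M + 1) × Fin m) ℝ) *ᵥ
          Sum.elim X U) (0, a) := rfl
  rw [this, fromCols_mulVec_sumElim, zero_mulVec, add_zero, kronecker_mulVec_apply,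
    Finset.sum_eq_single 0]
  · simp [unitVec]
  · intro j _ hj
    simp [unitVec, hj]
  · simp

theorem matPi_mulVec_succ (A : Matrix (Fin n) (Fin n) ℝ) (B : Matrix (Fin n) (Fin m) ℝ)
    (X : Fin N × Fin n → ℝ) (U : Fin N × Fin m → ℝ) (i : Fin N) :
    (fun a => (matPi N A B *ᵥ Sum.elim X U) (i.succ, a)) =
      (A *ᵥ fun t => X (i, t)) + B *ᵥ fun b => U (i, b) := by
  funext a
  have : (matPi N A B *ᵥ Sum.elim X U) (i.succ, a) =
      (fromCols ((1 : Matrix (Fin N) (Fin N) ℝ) ⊗ₖ A) ((1 : Matrix (Fin N) (Fin N) ℝ) ⊗ₖ B) *ᵥ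
          Sum.elim X U) (i, a) := rfl
  rw [this, fromCols_mulVec_sumElim, Pi.add_apply, one_kronecker_mulVec_apply,
    one_kronecker_mulVec_apply, Pi.add_apply]

/-- On the kernel of `𝒞(𝓕)` the quadratic form `Πᵀ 𝒳(P,1) Π` is the Lyapunov difference over
one period, and the kernel is parametrized by the initial state. -/
theorem kernel_quadForm {M : ℕ} (A : Matrix (Fin n) (Fin n) ℝ)
    (B : Matrix (Fin n) (Fin m) ℝ) (C : Matrix (Fin p) (Fin n) ℝ)
    {𝓕 : Matrix (Fin (M + 1) × Fin m) (Fin (M + 1) × Fin p) ℝ} (h𝓕 : IsBlockLower 𝓕)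
    (P : Matrix (Fin n) (Fin n) ℝ) (z : (Fin (M + 1) × Fin n) ⊕ (Fin (M + 1) × Fin m) → ℝ)
    (hz : matC A B C 𝓕 *ᵥ z = 0) :
    (z ⬝ᵥ ((matPi (M + 1) A B)ᵀ * matX (M + 1) (M + 1) P 1 * matPi (M + 1) A B) *ᵥ z =
      -((fun t => z (Sum.inl (0, t))) ⬝ᵥ P *ᵥ fun t => z (Sum.inl (0, t))) +
      (ltiMatrix A B C 𝓕 *ᵥ fun t => z (Sum.inl (0, t))) ⬝ᵥ P *ᵥ
        (ltiMatrix A B C 𝓕 *ᵥ fun t => z (Sum.inl (0, t)))) ∧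
    ((fun t => z (Sum.inl (0, t))) = 0 → z = 0) := by
  obtain ⟨X, U, rfl⟩ : ∃ X U, z = Sum.elim X U := ⟨z ∘ Sum.inl, z ∘ Sum.inr, by simp⟩
  rw [matC_mulVec_eq_zero_iff] at hz
  obtain ⟨hU, hX⟩ := hz
  simp only [Sum.elim_inl]
  set xl : Fin n → ℝ := (A *ᵥ fun t => X (Fin.last M, t)) + B *ᵥ fun b => U (Fin.last M, b)
    with hxl
  -- The end-of-period state is not a coordinate of `z`, so it is appended; beyond index `M + 1` the
  -- values are irrelevant.
  set x : ℕ → Fin n → ℝ := fun j => if h : j < M + 1 then fun t => X (⟨j, h⟩, t) else xl with hxdef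
  have hxi : ∀ i : Fin (M + 1), x i = fun t => X (i, t) := fun i => by
    exact dif_pos i.2
  have hxN : x (M + 1) = xl := by simp [hxdef]
  have hcl : ∀ i : Fin (M + 1), closedLoop A B C 𝓕 x i =
      (A *ᵥ fun t => X (i, t)) + B *ᵥ fun b => U (i, b) := fun i => by
    rw [closedLoop, hU]
    simp only [hxi]
  have hx : ∀ k : Fin (M + 1), x (k + 1) = closedLoop A B C 𝓕 x k := by
    intro k
    rw [hcl]
    induction k using Fin.lastCases with
    | last => rw [Fin.val_last, hxN, hxl]
    | cast i => rw [← hX i, ← hxi i.succ, Fin.val_succ, Fin.val_castSucc]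
  have hx0 : x 0 = fun t => X (0, t) := hxi 0
  rw [← hx0]
  refine ⟨?_, fun h0 => ?_⟩
  · rw [quadForm_congr, quadForm_matX, matPi_mulVec_zero, ltiMatrix_mulVec h𝓕 hx, hxN, hx0,
      ← Fin.succ_last, matPi_mulVec_succ]
  · have hcol := stateColumn_mulVec A B C (M + 1) 𝓕 h𝓕 x hx
    rw [h0, mulVec_zero] at hcol
    have hX0 : X = 0 := by
      funext ⟨i, a⟩
      have := congrFun hcol (i.castSucc, a)
      simp only [Fin.val_castSucc, hxi] at this
      exact this.symm
    have hU0 : U = 0 := by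
      rw [hU, hX0]
      have h1 : (fun t : Fin n => (0 : Fin (M + 1) × Fin n → ℝ) (0, t)) = 0 := rfl
      have h2 : (fun q : Fin (M + 1) × Fin p =>
          (C *ᵥ fun t : Fin n => (0 : Fin (M + 1) × Fin n → ℝ) (q.1, t)) q.2) = 0 := by
        funext q
        exact congrFun (mulVec_zero C) q.2
      rw [h2, mulVec_zero]
    rw [hX0, hU0, Sum.elim_zero_zero]

/-- Every initial state is realized in the kernel, so an inequality on the kernel becomes one for
all states. -/
theorem exists_kernel_vector {M : ℕ} (A : Matrix (Fin n) (Fin n) ℝ)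
    (B : Matrix (Fin n) (Fin m) ℝ) (C : Matrix (Fin p) (Fin n) ℝ)
    {𝓕 : Matrix (Fin (M + 1) × Fin m) (Fin (M + 1) × Fin p) ℝ} (h𝓕 : IsBlockLower 𝓕)
    (x₀ : Fin n → ℝ) :
    ∃ z : (Fin (M + 1) × Fin n) ⊕ (Fin (M + 1) × Fin m) → ℝ,
      matC A B C 𝓕 *ᵥ z = 0 ∧ (fun t => z (Sum.inl (0, t))) = x₀ := by
  obtain ⟨x, h0, hx⟩ := exists_closedLoop A B C h𝓕 x₀
  refine ⟨Sum.elim (fun q => x q.1 q.2) (𝓕 *ᵥ fun q => (C *ᵥ x q.1) q.2), ?_, h0⟩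
  rw [matC_mulVec_eq_zero_iff]
  exact ⟨rfl, fun i => hx i.castSucc⟩

/-! ### The synthesis inequalities and the Lyapunov inequality -/

theorem exists_synthesisBMI (hN : 1 ≤ N) {A : Matrix (Fin n) (Fin n) ℝ}
    {B : Matrix (Fin n) (Fin m) ℝ} {C : Matrix (Fin p) (Fin n) ℝ}
    {𝓕 : Matrix (Fin N × Fin m) (Fin N × Fin p) ℝ} (h𝓕 : IsBlockLower 𝓕)
    {𝓚 : Matrix (Fin N × Fin m) (Fin N × Fin n) ℝ} (h𝓚 : IsBlockLower 𝓚)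
    {P : Matrix (Fin n) (Fin n) ℝ} (hP𝓕 : P ∈ lyapunovSet (ltiMatrix A B C 𝓕))
    (hP𝓚 : P ∈ lyapunovSet (ltiMatrix A B 1 𝓚)) :
    ∃ V, SynthesisBMI A B C 𝓚 P V 𝓕 := by
  obtain ⟨M, rfl⟩ : ∃ M, N = M + 1 := ⟨N - 1, by omega⟩
  have key : ∀ {q : ℕ} (D : Matrix (Fin q) (Fin n) ℝ)
      (𝓖 : Matrix (Fin (M + 1) × Fin m) (Fin (M + 1) × Fin q) ℝ), IsBlockLower 𝓖 →
      P ∈ lyapunovSet (ltiMatrix A B D 𝓖) → ∀ z, z ≠ 0 → matC A B D 𝓖 *ᵥ z = 0 →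
      z ⬝ᵥ ((matPi (M + 1) A B)ᵀ * matX (M + 1) (M + 1) P 1 * matPi (M + 1) A B) *ᵥ z < 0 := by
    intro q D 𝓖 h𝓖 hP z hz hker
    obtain ⟨h1, h2⟩ := kernel_quadForm A B D h𝓖 P z hker
    have h3 := (negDef_iff.1 hP.2).2 _ (mt h2 hz)
    rw [sub_mulVec, dotProduct_sub, quadForm_congr] at h3
    rw [h1]
    linarith
  have hsymm : ((matPi (M + 1) A B)ᵀ * matX (M + 1) (M + 1) P 1 * matPi (M + 1) A B).IsSymm := by
    have := (matX_isSymm (posDef_iff_quadForm.1 hP𝓕.1).1 (M + 1)).eq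
    simp [Matrix.IsSymm, transpose_mul, this, Matrix.mul_assoc]
  obtain ⟨V, hV⟩ := exists_multiplier hsymm (matC A B 1 𝓚) (matC A B C 𝓕)
    (key 1 𝓚 h𝓚 hP𝓚) (key C 𝓕 h𝓕 hP𝓕)
  refine ⟨V, hP𝓕.1, ?_⟩
  rw [matH_eq_matC]
  exact hV

/-- Testing the inequality on kernel vectors of `matC` removes the multiplier term, whatever `𝓚` and
`V` are. -/
theorem SynthesisBMI.lyapunov (hN : 1 ≤ N) {A : Matrix (Fin n) (Fin n) ℝ}
    {B : Matrix (Fin n) (Fin m) ℝ} {C : Matrix (Fin p) (Fin n) ℝ}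
    {𝓕 : Matrix (Fin N × Fin m) (Fin N × Fin p) ℝ} (h𝓕 : IsBlockLower 𝓕)
    {𝓚 : Matrix (Fin N × Fin m) (Fin N × Fin n) ℝ} {P : Matrix (Fin n) (Fin n) ℝ}
    {V : Matrix ((Fin N × Fin m) ⊕ (Fin (N - 1) × Fin n))
      ((Fin N × Fin m) ⊕ (Fin (N - 1) × Fin n)) ℝ}
    (h : SynthesisBMI A B C 𝓚 P V 𝓕) (x : Fin n → ℝ) (hx : x ≠ 0) :
    (ltiMatrix A B C 𝓕 *ᵥ x) ⬝ᵥ P *ᵥ (ltiMatrix A B C 𝓕 *ᵥ x) < x ⬝ᵥ P *ᵥ x := by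
  obtain ⟨M, rfl⟩ : ∃ M, N = M + 1 := ⟨N - 1, by omega⟩
  obtain ⟨z, hz, rfl⟩ := exists_kernel_vector A B C h𝓕 x
  have hz0 : z ≠ 0 := by
    rintro rfl
    exact hx rfl
  have h1 := (negDef_iff.1 h.2).2 z hz0
  rw [add_mulVec, dotProduct_add, quadForm_he, ← mulVec_mulVec _ _ (matC A B C 𝓕), hz,
    mulVec_zero, dotProduct_zero, (kernel_quadForm A B C h𝓕 P z hz).1] at h1
  linarith

/-! ### Block lower triangular gains -/

theorem isBlockLower_gainMatrix (N : ℕ) (F : ℕ → ℕ → Matrix (Fin m) (Fin p) ℝ) :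
    IsBlockLower (gainMatrix N F) := fun r c h => by
  simp [gainMatrix, not_le.2 h]

theorem blockUpper_apply_eq_zero {a b : ℕ} (G : Fin N → Fin N → Matrix (Fin a) (Fin b) ℝ)
    {r : Fin N × Fin a} {c : Fin N × Fin b} (h : c.1 < r.1) : blockUpper G r c = 0 := by
  simp [blockUpper, not_le.2 h]

/-- A singular matrix has inverse `0` by convention, so invertibility need not be assumed. -/
theorem inv_blockUpper_apply_eq_zero (G : Fin N → Fin N → Matrix (Fin n) (Fin n) ℝ)
    {r c : Fin N × Fin n} (h : c.1 < r.1) : (blockUpper G)⁻¹ r c = 0 := by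
  by_cases hG : IsUnit (blockUpper G)
  · have := hG.invertible
    have hb : BlockTriangular (blockUpper G) Prod.fst := fun _ _ h => blockUpper_apply_eq_zero G h
    exact blockTriangular_inv_of_blockTriangular hb h
  · rw [nonsing_inv_apply_not_isUnit _ (by rwa [← isUnit_iff_isUnit_det])]
    rfl

theorem matT_eq_zero {i j : Fin N} (h : (i : ℕ) + j + 1 ≠ N) : matT N i j = 0 := by
  simp [matT, h]

/-- `J G⁻¹` is block upper triangular, and reversing the block order on both sides turns upper into
lower. -/
theorem isBlockLower_sfGain (J : Fin N → Fin N → Matrix (Fin m) (Fin n) ℝ)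
    (G : Fin N → Fin N → Matrix (Fin n) (Fin n) ℝ) : IsBlockLower (sfGain J G) := by
  intro r c hrc
  have hW : ∀ u v, v.1 < u.1 → (blockUpper J * (blockUpper G)⁻¹) u v = 0 := by
    intro u v huv
    rw [Matrix.mul_apply]
    refine Finset.sum_eq_zero fun q _ => ?_
    rcases lt_or_ge q.1 u.1 with h | h
    · rw [blockUpper_apply_eq_zero J h, zero_mul]
    · rw [inv_blockUpper_apply_eq_zero G (huv.trans_le h), mul_zero]
  rw [sfGain, Matrix.mul_assoc (matT N ⊗ₖ _), Matrix.mul_apply]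
  refine Finset.sum_eq_zero fun v _ => ?_
  rw [Matrix.mul_apply, Finset.sum_mul]
  refine Finset.sum_eq_zero fun u _ => ?_
  simp only [kroneckerMap_apply]
  by_cases h1 : (r.1 : ℕ) + u.1 + 1 = N
  · by_cases h2 : (v.1 : ℕ) + c.1 + 1 = N
    · have : v.1 < u.1 := by
        rw [Fin.lt_def] at hrc ⊢
        omega
      rw [hW u v this, mul_zero, zero_mul]
    · rw [matT_eq_zero h2, zero_mul, mul_zero]
  · rw [matT_eq_zero h1, zero_mul, zero_mul, zero_mul]

/-- Block column `s` carries the gain of delay `i = k - s`; reflecting the sum passes from columns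
to delays. -/
theorem gainMatrix_mulVec_apply (F : ℕ → ℕ → Matrix (Fin m) (Fin p) ℝ) (v : ℕ → Fin p → ℝ)
    (k : Fin N) (b : Fin m) :
    (gainMatrix N F *ᵥ fun q => v q.1 q.2) (k, b) =
      (∑ i ∈ Finset.range ((k : ℕ) + 1), F k i *ᵥ v (k - i)) b := by
  have h1 : (gainMatrix N F *ᵥ fun q => v q.1 q.2) (k, b) =
      ∑ s : Fin N, if (s : ℕ) < (k : ℕ) + 1 then (F k (k - s) *ᵥ v s) b else 0 := by
    simp only [mulVec, dotProduct, Fintype.sum_prod_type, gainMatrix, of_apply]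
    refine Finset.sum_congr rfl fun s _ => ?_
    by_cases hs : s ≤ k <;> simp [hs]
  have h2 : ∑ s : Fin N, (if (s : ℕ) < (k : ℕ) + 1 then (F k (k - s) *ᵥ v s) b else 0) =
      ∑ s ∈ Finset.range ((k : ℕ) + 1), (F k (k - s) *ᵥ v s) b := by
    rw [Fin.sum_univ_eq_sum_range
      (fun s => if s < (k : ℕ) + 1 then (F k (k - s) *ᵥ v s) b else 0) N,
      ← Finset.sum_filter]
    refine Finset.sum_congr ?_ fun _ _ => rfl
    ext s
    simp only [Finset.mem_filter, Finset.mem_range]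
    have := k.2
    omega
  rw [h1, h2, ← Finset.sum_range_reflect, Finset.sum_apply]
  refine Finset.sum_congr rfl fun i hi => ?_
  rw [Finset.mem_range] at hi
  have e1 : (k : ℕ) + 1 - 1 - i = k - i := by omega
  have e2 : (k : ℕ) - (k - i) = i := by omega
  rw [e1, e2]

/-! ### Stability of the periodic system -/

section

variable {A : Matrix (Fin n) (Fin n) ℝ} {B : Matrix (Fin n) (Fin m) ℝ}
  {C : Matrix (Fin p) (Fin n) ℝ} {F : ℕ → ℕ → Matrix (Fin m) (Fin p) ℝ}

/-- The controller's memory resets at multiples of `N`, so the segment from `t * N` solves the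
one-period recursion by itself. -/
theorem IsTrajectory.ltiMatrix_mulVec {k₀ : ℕ} {x : ℕ → Fin n → ℝ}
    (hx : IsTrajectory N A B C F k₀ x) {t : ℕ} (ht : k₀ ≤ t * N) :
    ltiMatrix A B C (gainMatrix N F) *ᵥ x (t * N) = x ((t + 1) * N) := by
  have h := PeriodicSOF.ltiMatrix_mulVec (A := A) (B := B) (C := C)
    (isBlockLower_gainMatrix N F) (x := fun j => x (t * N + j)) (fun k => by
      have hk : (t * N + k) % N = k := by
        rw [Nat.mul_add_mod', Nat.mod_eq_of_lt k.2]
      have := hx (t * N + k) (by omega)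
      rw [hk] at this
      rw [closedLoop, ← add_assoc, this]
      congr 2
      funext b
      rw [gainMatrix_mulVec_apply F (fun j => C *ᵥ x (t * N + j))]
      simp only [Finset.sum_apply]
      refine Finset.sum_congr rfl fun i hi => ?_
      rw [Finset.mem_range] at hi
      rw [Nat.add_sub_assoc (by omega)])
  rw [add_mul, one_mul]
  exact h

theorem exists_norm_mulVec_le {a b : ℕ} (M : Matrix (Fin a) (Fin b) ℝ) :
    ∃ K : ℝ, 0 ≤ K ∧ ∀ v, ‖M *ᵥ v‖ ≤ K * ‖v‖ :=
  ⟨‖M.mulVecLin.toContinuousLinearMap‖, norm_nonneg _,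
    fun v => M.mulVecLin.toContinuousLinearMap.le_opNorm v⟩

theorem exists_norm_step_le (hN : 1 ≤ N) (A : Matrix (Fin n) (Fin n) ℝ)
    (B : Matrix (Fin n) (Fin m) ℝ) (C : Matrix (Fin p) (Fin n) ℝ)
    (F : ℕ → ℕ → Matrix (Fin m) (Fin p) ℝ) :
    ∃ K : ℝ, 1 ≤ K ∧ ∀ (k₀ : ℕ) (x : ℕ → Fin n → ℝ), IsTrajectory N A B C F k₀ x →
      ∀ k, k₀ ≤ k → ∀ c : ℝ, (∀ i ≤ k % N, ‖x (k - i)‖ ≤ c) → ‖x (k + 1)‖ ≤ K * c := by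
  obtain ⟨a, ha0, ha⟩ := exists_norm_mulVec_le A
  obtain ⟨b, hb0, hb⟩ := exists_norm_mulVec_le B
  obtain ⟨c', hc0, hc⟩ := exists_norm_mulVec_le C
  choose f hf0 hf using fun r i => exists_norm_mulVec_le (F r i)
  -- Only finitely many gains occur; summing over all phases `r` makes the bound independent of
  -- time.
  set S : ℝ := ∑ r ∈ Finset.range N, ∑ i ∈ Finset.range (r + 1), f r i * c' with hS
  have hS0 : 0 ≤ S :=
    Finset.sum_nonneg fun r _ => Finset.sum_nonneg fun i _ => mul_nonneg (hf0 r i) hc0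
  refine ⟨1 + a + b * S, by nlinarith [mul_nonneg hb0 hS0], fun k₀ x hx k hk c hcx => ?_⟩
  have hc0' : 0 ≤ c := (norm_nonneg _).trans (hcx 0 (Nat.zero_le _))
  have hsum : ‖∑ i ∈ Finset.range (k % N + 1), F (k % N) i *ᵥ (C *ᵥ x (k - i))‖ ≤ S * c := by
    calc ‖∑ i ∈ Finset.range (k % N + 1), F (k % N) i *ᵥ (C *ᵥ x (k - i))‖
        ≤ ∑ i ∈ Finset.range (k % N + 1), f (k % N) i * c' * c := by
          refine norm_sum_le_of_le _ fun i hi => ?_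
          have hi' := hcx i (by rw [Finset.mem_range] at hi; omega)
          rw [mul_assoc]
          refine (hf _ _ _).trans (mul_le_mul_of_nonneg_left ((hc _).trans ?_) (hf0 _ _))
          exact mul_le_mul_of_nonneg_left hi' hc0
      _ = (∑ i ∈ Finset.range (k % N + 1), f (k % N) i * c') * c := by rw [Finset.sum_mul]
      _ ≤ S * c := by
          refine mul_le_mul_of_nonneg_right ?_ hc0'
          exact Finset.single_le_sum
            (f := fun r => ∑ i ∈ Finset.range (r + 1), f r i * c')
            (fun r _ => Finset.sum_nonneg fun i _ => mul_nonneg (hf0 r i) hc0)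
            (Finset.mem_range.2 (Nat.mod_lt k hN))
  rw [hx k hk]
  calc _ ≤ ‖A *ᵥ x k‖ +
        ‖B *ᵥ ∑ i ∈ Finset.range (k % N + 1), F (k % N) i *ᵥ (C *ᵥ x (k - i))‖ := norm_add_le _ _
    _ ≤ a * c + b * (S * c) := by
        refine add_le_add ((ha _).trans (mul_le_mul_of_nonneg_left (hcx 0 (Nat.zero_le _)) ha0))
          ((hb _).trans (mul_le_mul_of_nonneg_left hsum hb0))
    _ ≤ (1 + a + b * S) * c := by nlinarith

theorem exists_norm_period_le (hN : 1 ≤ N) (A : Matrix (Fin n) (Fin n) ℝ)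
    (B : Matrix (Fin n) (Fin m) ℝ) (C : Matrix (Fin p) (Fin n) ℝ)
    (F : ℕ → ℕ → Matrix (Fin m) (Fin p) ℝ) :
    ∃ K : ℝ, 0 < K ∧ ∀ (k₀ : ℕ) (x : ℕ → Fin n → ℝ), IsTrajectory N A B C F k₀ x →
      ∀ q k, q * N ≤ k₀ → k₀ ≤ k → k ≤ (q + 1) * N → ∀ c : ℝ,
        (∀ l, q * N ≤ l → l ≤ k₀ → ‖x l‖ ≤ c) → ‖x k‖ ≤ K * c := by
  obtain ⟨K, hK1, hK⟩ := exists_norm_step_le hN A B C F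
  -- At most `N` steps remain in the period, each costing a factor `K ≥ 1`.
  refine ⟨K ^ N, by positivity, fun k₀ x hx q k hq hk₀ hk c hc => ?_⟩
  have hc0 : 0 ≤ c := (norm_nonneg _).trans (hc k₀ hq le_rfl)
  have hqN : (q + 1) * N = q * N + N := by ring
  have key : ∀ j, k₀ + j ≤ (q + 1) * N → ∀ l, q * N ≤ l → l ≤ k₀ + j → ‖x l‖ ≤ K ^ j * c := by
    intro j
    induction j with
    | zero => simpa using fun _ => hc
    | succ j ih =>
      intro hj l hl hlj
      have ih' := ih (by omega)
      rcases Nat.lt_or_ge l (k₀ + j + 1) with h | h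
      · refine (ih' l hl (by omega)).trans (mul_le_mul_of_nonneg_right ?_ hc0)
        exact pow_le_pow_right₀ hK1 (Nat.le_succ j)
      · obtain rfl : l = k₀ + j + 1 := by omega
        rw [pow_succ', mul_assoc]
        refine hK k₀ x hx (k₀ + j) (by omega) _ fun i hi => ih' _ ?_ (by omega)
        -- Time `k₀ + j` is still strictly inside period `q`, so the controller looks back no
        -- further than `q * N`.
        have hmod : (k₀ + j) % N = k₀ + j - q * N := by
          have e : k₀ + j = q * N + (k₀ + j - q * N) := by omega
          conv_lhs => rw [e]
          rw [Nat.mul_add_mod', Nat.mod_eq_of_lt (by omega)]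
        omega
  have h := key (k - k₀) (by omega) k (by omega) (by omega)
  refine h.trans (mul_le_mul_of_nonneg_right (pow_le_pow_right₀ hK1 (by omega)) hc0)

theorem IsTrajectory.mono {k₀ k₁ : ℕ} {x : ℕ → Fin n → ℝ} (hx : IsTrajectory N A B C F k₀ x)
    (h : k₀ ≤ k₁) : IsTrajectory N A B C F k₁ x := fun k hk => hx k (h.trans hk)

/-- Asymptotic stability of the equivalent LTI system implies that of the periodic system. -/
theorem periodicAsympStable_of_lti (hN : 1 ≤ N)
    (h : LTIAsympStable (ltiMatrix A B C (gainMatrix N F))) : PeriodicAsympStable N A B C F := by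
  obtain ⟨K, hK0, hK⟩ := exists_norm_period_le hN A B C F
  intro k₀
  set q := k₀ / N with hq
  have hqN : (q + 1) * N = q * N + N := by ring
  have hdm : q * N + k₀ % N = k₀ := Nat.div_add_mod' k₀ N
  have hmod : k₀ % N < N := Nat.mod_lt _ hN
  -- Sampling starts at the first multiple of `N` after `k₀`, as the period containing `k₀` may be
  -- entered midway.
  have hφ : ∀ x, IsTrajectory N A B C F k₀ x → ∀ t, x ((q + 1 + (t + 1)) * N) =
      ltiMatrix A B C (gainMatrix N F) *ᵥ x ((q + 1 + t) * N) := by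
    intro x hx t
    have : (q + 1) * N ≤ (q + 1 + t) * N := Nat.mul_le_mul_right _ (by omega)
    exact (hx.ltiMatrix_mulVec (t := q + 1 + t) (by omega)).symm
  have hlate : ∀ x, IsTrajectory N A B C F k₀ x → ∀ k, (q + 1) * N ≤ k →
      ‖x k‖ ≤ K * ‖x ((q + 1 + (k / N - (q + 1))) * N)‖ := by
    intro x hx k hk
    have h1 : q + 1 ≤ k / N := (Nat.le_div_iff_mul_le hN).2 hk
    rw [Nat.add_sub_cancel' h1]
    have h2 : k / N * N + k % N = k := Nat.div_add_mod' k N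
    have h3 : (k / N + 1) * N = k / N * N + N := by ring
    have h4 : (q + 1) * N ≤ k / N * N := Nat.mul_le_mul_right _ h1
    have h5 : k % N < N := Nat.mod_lt _ hN
    refine hK (k / N * N) x (hx.mono (by omega)) (k / N) k le_rfl (by omega) (by omega) _
      fun l hl hl' => ?_
    rw [le_antisymm hl' hl]
  constructor
  · intro ε hε
    obtain ⟨δ, hδ, hst⟩ := h.1 (ε / K) (by positivity)
    -- The minimum covers both the initial partial period (`ε`) and the first sample (`δ`); the
    -- factor `2` restores strictness.
    refine ⟨min ε δ / (2 * K), by positivity, fun x hx hinit k hk => ?_⟩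
    have hfirst : ∀ k, k₀ ≤ k → k ≤ (q + 1) * N → ‖x k‖ < min ε δ := by
      intro k hk hk'
      refine (hK k₀ x hx q k (by omega) hk hk' (min ε δ / (2 * K)) fun l hl hl' => ?_).trans_lt ?_
      · have := hinit (k₀ - l) (by omega)
        rw [Nat.sub_sub_self hl'] at this
        exact this.le
      · have hm : 0 < min ε δ := lt_min hε hδ
        have : K * (min ε δ / (2 * K)) = min ε δ / 2 := by field_simp
        linarith
    rcases le_or_gt k ((q + 1) * N) with hk' | hk'
    · exact (hfirst k hk hk').trans_le (min_le_left _ _)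
    · refine (hlate x hx k hk'.le).trans_lt ?_
      have := hst (fun t => x ((q + 1 + t) * N)) (hφ x hx)
        ((hfirst _ (by omega) le_rfl).trans_le (min_le_right _ _)) (k / N - (q + 1))
      rwa [lt_div_iff₀' hK0] at this
  · intro x hx
    have h1 := h.2 (fun t => x ((q + 1 + t) * N)) (hφ x hx)
    have h2 : Tendsto (fun k => k / N - (q + 1)) atTop atTop :=
      (tendsto_sub_atTop_nat (q + 1)).comp (Nat.tendsto_div_const_atTop (by omega))
    have h3 := ((h1.comp h2).norm.const_mul K)
    rw [norm_zero, mul_zero] at h3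
    exact squeeze_zero_norm' ((eventually_ge_atTop ((q + 1) * N)).mono (hlate x hx)) h3

end

theorem SynthesisBMI.ltiAsympStable (hN : 1 ≤ N) {A : Matrix (Fin n) (Fin n) ℝ}
    {B : Matrix (Fin n) (Fin m) ℝ} {C : Matrix (Fin p) (Fin n) ℝ}
    {F : ℕ → ℕ → Matrix (Fin m) (Fin p) ℝ}
    {𝓚 : Matrix (Fin N × Fin m) (Fin N × Fin n) ℝ} {P : Matrix (Fin n) (Fin n) ℝ}
    {V : Matrix ((Fin N × Fin m) ⊕ (Fin (N - 1) × Fin n))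
      ((Fin N × Fin m) ⊕ (Fin (N - 1) × Fin n)) ℝ}
    (h : SynthesisBMI A B C 𝓚 P V (gainMatrix N F)) :
    LTIAsympStable (ltiMatrix A B C (gainMatrix N F)) :=
  ltiAsympStable_of_lyapunov h.1 (h.lyapunov hN (isBlockLower_gainMatrix N F))

end PeriodicSOF

theorem corollary1 (n m p N : ℕ) (hN : 1 ≤ N)
    (A : Matrix (Fin n) (Fin n) ℝ) (B : Matrix (Fin n) (Fin m) ℝ) (C : Matrix (Fin p) (Fin n) ℝ)
    (Phat : Matrix (Fin n) (Fin n) ℝ)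
    (Jhat : Fin N → Fin N → Matrix (Fin m) (Fin n) ℝ)
    (Ghat : Fin N → Fin N → Matrix (Fin n) (Fin n) ℝ)
    (Fhat : Matrix (Fin N × Fin m) (Fin N × Fin n) ℝ)
    (hLMI : EbiharaLMI A B Phat Jhat Ghat)
    (hFhat : Fhat = sfGain Jhat Ghat)
    (hne : (lyapunovSet (ltiMatrix A B (1 : Matrix (Fin n) (Fin n) ℝ) Fhat) ∩
      lyapunovUnion N A B C).Nonempty) :
    -- the equivalence for the periodic control system
    ((∃ F : ℕ → ℕ → Matrix (Fin m) (Fin p) ℝ, PeriodicAsympStable N A B C F) ↔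
      ∃ (F : ℕ → ℕ → Matrix (Fin m) (Fin p) ℝ) (P : Matrix (Fin n) (Fin n) ℝ)
        (V : Matrix ((Fin N × Fin m) ⊕ (Fin (N - 1) × Fin n))
          ((Fin N × Fin m) ⊕ (Fin (N - 1) × Fin n)) ℝ),
        SynthesisBMI A B C Fhat P V (gainMatrix N F)) ∧
    -- the equivalence for the LTI system
    ((∃ F : ℕ → ℕ → Matrix (Fin m) (Fin p) ℝ,
        LTIAsympStable (ltiMatrix A B C (gainMatrix N F))) ↔
      ∃ (F : ℕ → ℕ → Matrix (Fin m) (Fin p) ℝ) (P : Matrix (Fin n) (Fin n) ℝ)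
        (V : Matrix ((Fin N × Fin m) ⊕ (Fin (N - 1) × Fin n))
          ((Fin N × Fin m) ⊕ (Fin (N - 1) × Fin n)) ℝ),
        SynthesisBMI A B C Fhat P V (gainMatrix N F)) ∧
    -- a gain matrix with which the inequalities are satisfied is itself stabilizing
    (∀ (F : ℕ → ℕ → Matrix (Fin m) (Fin p) ℝ) (P : Matrix (Fin n) (Fin n) ℝ)
        (V : Matrix ((Fin N × Fin m) ⊕ (Fin (N - 1) × Fin n))
          ((Fin N × Fin m) ⊕ (Fin (N - 1) × Fin n)) ℝ),
        SynthesisBMI A B C Fhat P V (gainMatrix N F) →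
          PeriodicAsympStable N A B C F ∧ LTIAsympStable (ltiMatrix A B C (gainMatrix N F))) := by
  have stable : ∀ (F : ℕ → ℕ → Matrix (Fin m) (Fin p) ℝ) (P : Matrix (Fin n) (Fin n) ℝ)
      (V : Matrix ((Fin N × Fin m) ⊕ (Fin (N - 1) × Fin n))
        ((Fin N × Fin m) ⊕ (Fin (N - 1) × Fin n)) ℝ),
      SynthesisBMI A B C Fhat P V (gainMatrix N F) →
        PeriodicAsympStable N A B C F ∧ LTIAsympStable (ltiMatrix A B C (gainMatrix N F)) :=
    fun F P V h => ⟨periodicAsympStable_of_lti hN (h.ltiAsympStable hN), h.ltiAsympStable hN⟩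
  have feasible : ∃ (F : ℕ → ℕ → Matrix (Fin m) (Fin p) ℝ) (P : Matrix (Fin n) (Fin n) ℝ)
      (V : Matrix ((Fin N × Fin m) ⊕ (Fin (N - 1) × Fin n))
        ((Fin N × Fin m) ⊕ (Fin (N - 1) × Fin n)) ℝ),
      SynthesisBMI A B C Fhat P V (gainMatrix N F) := by
    -- The common Lyapunov matrix from (b) and the output gain behind it serve as witnesses.
    obtain ⟨P, hPK, hPU⟩ := hne
    simp only [lyapunovUnion, Set.mem_iUnion] at hPU
    obtain ⟨𝓕, ⟨⟨F, rfl⟩, -⟩, hPF⟩ := hPU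
    subst hFhat
    obtain ⟨V, hV⟩ := exists_synthesisBMI hN (isBlockLower_gainMatrix N F)
      (isBlockLower_sfGain Jhat Ghat) hPF hPK
    exact ⟨F, P, V, hV⟩
  exact ⟨⟨fun _ => feasible, fun ⟨F, P, V, h⟩ => ⟨F, (stable F P V h).1⟩⟩,
    ⟨fun _ => feasible, fun ⟨F, P, V, h⟩ => ⟨F, (stable F P V h).2⟩⟩, stable⟩
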